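/- Let $G=(V,E)$ be a finite simple graph with $n$ vertices, minimum degree $d$ and maximum degree $\Delta$, and let $k\ge 1$. For each edge $vw\in E$ let $\mathcal M_{vw}$ be a random (perfect) matching of the sets $\{v\}\times[k]$ and $\{w\}\times[k]$, and let $G^{(k)}$ be the graph with vertex set $V\times[k]$ and edge set $\bigcup_{vw\in E}\mathcal M_{vw}$ (a random $k$-lift of $G$). Assume that the matchings $\mathcal M_{vw}$, $vw\in E$, are independent and that $\Pr(\{(v,\ell),(w,r)\}\in\mathcal M_{vw})=1/k$ for all $vw\in E$ and $\ell,r\in[k]$; they need not be uniformly distributed. For a finite graph $H$ with adjacency matrix $A_H$, the Laplacian is $\mathcal L_H=I-T_HA_HT_H$, where $T_H$ is the diagonal matrix with entries $\deg_H(v)^{-1/2}$ (or $0$ if $\deg_H(v)=0$). Let $\mathrm{new}(A^{(k)})$ be the multiset difference of the spectra (eigenvalues with multiplicity) of $A_{G^{(k)}}$ and $A_G$, and let $\mathrm{new}(\mathcal L^{(k)})$ be the multiset difference of the spectra of $\mathcal L_{G^{(k)}}$ and $\mathcal L_G$. Then for every $\delta\in(0,1)$, $$\Pr\Big(|\eta|\le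 16\sqrt{\Delta\ln(2nk/\delta)}\ \text{ for all } \eta\in\mathrm{new}(A^{(k)})\Big)\ge 1-\delta,$$ and, if $d\ge 1$, $$\Pr\Big(|1-\beta|\le 16\sqrt{\frac{\ln(2nk/\delta)}{d}}\ \text{ for all } \beta\in\mathrm{new}(\mathcal L^{(k)})\Big)\ge 1-\delta.$$ -/

import Mathlib

open MeasureTheory ProbabilityTheory

noncomputable section

/-- `M` is a (perfect) matching of the sets `S` and `T`: a set of unordered pairs `{a, f a}`,
`a ∈ S`, for some bijection `f` from `S` to `T`. -/
def IsMatchingOf {α : Type*} (S T : Set α) (M : Set (Sym2 α)) : Prop :=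
  ∃ f : α → α, Set.BijOn f S T ∧ M = (fun a => s(a, f a)) '' S

/-- The set `{v} × [k]` of copies of `v`. -/
def copies {V : Type*} (k : ℕ) (v : V) : Set (V × Fin k) := {x | x.1 = v}

/-- The type of all matchings of the copies of `v` and the copies of `w`, where `e = vw`.
(The condition below is symmetric in `v` and `w`.) -/
structure EdgeMatching {V : Type*} (k : ℕ) (e : Sym2 V) where
  /-- The pairs of the matching. -/
  pairs : Set (Sym2 (V × Fin k))
  isMatching : ∀ v w : V, e = s(v, w) → IsMatchingOf (copies k v) (copies k w) pairs

/-- Every set of matchings is an event (for finite `V` this is a finite discrete space). -/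
instance {V : Type*} (k : ℕ) (e : Sym2 V) : MeasurableSpace (EdgeMatching k e) := ⊤

/-- The `k`-lift of `G` given by a choice of matchings: its vertex set is `V × [k]`, its edge set
the union of the matchings. -/
def kLift {V : Type*} (G : SimpleGraph V) (k : ℕ)
    (M : (e : G.edgeSet) → EdgeMatching k (e : Sym2 V)) : SimpleGraph (V × Fin k) :=
  SimpleGraph.fromEdgeSet (⋃ e : G.edgeSet, (M e).pairs)

instance {V : Type*} (G : SimpleGraph V) (k : ℕ)
    (M : (e : G.edgeSet) → EdgeMatching k (e : Sym2 V)) : DecidableRel (kLift G k M).Adj :=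
  Classical.decRel _

/-- The diagonal matrix with entries `deg(v)^{-1/2}`, or `0` if `deg(v) = 0`. -/
def invSqrtDegMatrix {W : Type*} [Fintype W] [DecidableEq W]
    (H : SimpleGraph W) [DecidableRel H.Adj] : Matrix W W ℝ :=
  Matrix.diagonal fun v => if H.degree v = 0 then 0 else (√(H.degree v : ℝ))⁻¹

/-- The (normalized) Laplacian `I - T A T` of a graph. -/
def normLaplacian {W : Type*} [Fintype W] [DecidableEq W]
    (H : SimpleGraph W) [DecidableRel H.Adj] : Matrix W W ℝ :=
  1 - invSqrtDegMatrix H * H.adjMatrix ℝ * invSqrtDegMatrix H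

theorem isHermitian_adjMatrix {W : Type*} [Fintype W] [DecidableEq W]
    (H : SimpleGraph W) [DecidableRel H.Adj] : (H.adjMatrix ℝ).IsHermitian := by
  rw [Matrix.IsHermitian, Matrix.conjTranspose_eq_transpose_of_trivial,
    SimpleGraph.transpose_adjMatrix]

theorem isHermitian_normLaplacian {W : Type*} [Fintype W] [DecidableEq W]
    (H : SimpleGraph W) [DecidableRel H.Adj] : (normLaplacian H).IsHermitian := by
  simp [Matrix.IsHermitian, normLaplacian, invSqrtDegMatrix,
    Matrix.conjTranspose_eq_transpose_of_trivial, Matrix.mul_assoc]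

/-- The multiset of eigenvalues of the adjacency matrix, with multiplicity. -/
def adjSpec {W : Type*} [Fintype W] [DecidableEq W]
    (H : SimpleGraph W) [DecidableRel H.Adj] : Multiset ℝ :=
  Finset.univ.val.map (isHermitian_adjMatrix H).eigenvalues

/-- The multiset of eigenvalues of the Laplacian, with multiplicity. -/
def lapSpec {W : Type*} [Fintype W] [DecidableEq W]
    (H : SimpleGraph W) [DecidableRel H.Adj] : Multiset ℝ :=
  Finset.univ.val.map (isHermitian_normLaplacian H).eigenvalues

/-- New adjacency eigenvalues of a lift: multiset difference of the two spectra. -/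
def newAdj {V : Type*} [Fintype V] [DecidableEq V] (G : SimpleGraph V) [DecidableRel G.Adj]
    (k : ℕ) (M : (e : G.edgeSet) → EdgeMatching k (e : Sym2 V)) : Multiset ℝ :=
  adjSpec (kLift G k M) - adjSpec G

/-- New Laplacian eigenvalues of a lift: multiset difference of the two spectra. -/
def newLap {V : Type*} [Fintype V] [DecidableEq V] (G : SimpleGraph V) [DecidableRel G.Adj]
    (k : ℕ) (M : (e : G.edgeSet) → EdgeMatching k (e : Sym2 V)) : Multiset ℝ :=
  lapSpec (kLift G k M) - lapSpec G

end

/-! With P the map from copies to vertices and Q the average of the scaled adjacency over copies,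
the scaled adjacency matrix of the lift is S + PQ. Here S is a sum of independent centred blocks,
one per edge (`sum_matchingBlock`). Each block annihilates P, and QP is the scaled adjacency matrix
of G. Hence SP = 0, the characteristic polynomial factors (`charpoly_add_mul_mul_X_pow`), and every
new eigenvalue is an eigenvalue of S. The Laplacian is the same argument with degree scaling, since
a lift preserves degrees.

It remains to bound the spectrum of S. The squared norm of a block's action is dominated by a
diagonal quadratic form. Resampling one block gives an exchangeable pair, and a trace mean
inequality then bounds the trace moments inductively: E tr S^(2r) ≤ (4rv)^r N, where N is the
dimension and v bounds the summed diagonals (`sum_weight_trace_pow_le`). Markov's inequality with r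
about ln(2N/δ) gives the tail. The parameter v is Δ for adjacency and 1/d for the Laplacian. -/

/-! ### Trace inequalities for real symmetric matrices -/

section Trace

variable {W : Type*} [Fintype W] [DecidableEq W]

/-- A real Hermitian matrix diagonalises, simultaneously for all its powers. -/
theorem Matrix.IsHermitian.exists_pow_eq_conj_diagonal {S : Matrix W W ℝ} (hS : S.IsHermitian) :
    ∃ U : Matrix W W ℝ, U.transpose * U = 1 ∧ ∀ q : ℕ,
      S ^ q = U * Matrix.diagonal (fun i => hS.eigenvalues i ^ q) * U.transpose := by
  refine ⟨(hS.eigenvectorUnitary : Matrix W W ℝ), ?_, fun q => ?_⟩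
  · have := Unitary.coe_star_mul_self hS.eigenvectorUnitary
    simpa [Matrix.star_eq_conjTranspose] using this
  · have h1 : (hS.eigenvectorUnitary : Matrix W W ℝ).transpose *
        (hS.eigenvectorUnitary : Matrix W W ℝ) = 1 := by
      have := Unitary.coe_star_mul_self hS.eigenvectorUnitary
      simpa [Matrix.star_eq_conjTranspose] using this
    have h2 : (hS.eigenvectorUnitary : Matrix W W ℝ) *
        (hS.eigenvectorUnitary : Matrix W W ℝ).transpose = 1 := by
      exact mul_eq_one_comm.mp h1
    have h3 : S = (hS.eigenvectorUnitary : Matrix W W ℝ) * Matrix.diagonal hS.eigenvalues *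
        (hS.eigenvectorUnitary : Matrix W W ℝ).transpose := by
      have := hS.spectral_theorem
      simpa [Unitary.conjStarAlgAut_apply, Matrix.star_eq_conjTranspose, Function.comp_def] using this
    generalize (hS.eigenvectorUnitary : Matrix W W ℝ) = U at *
    generalize hS.eigenvalues = l at *
    induction q with
    | zero => simp [h2]
    | succ q ih =>
      rw [pow_succ, ih]
      conv_lhs => rw [h3]
      have : U * Matrix.diagonal (fun i => l i ^ q) * U.transpose *
          (U * Matrix.diagonal l * U.transpose) = U * Matrix.diagonal (fun i => l i ^ q) *
          (U.transpose * U) * Matrix.diagonal l * U.transpose := by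
        simp only [Matrix.mul_assoc]
      rw [this, h1, Matrix.mul_one, Matrix.mul_assoc U, Matrix.diagonal_mul_diagonal]
      simp only [pow_succ]

/-- The squares are nonnegative weights independent of `l` and `m`, so trace inequalities reduce to
scalar ones for pairs of eigenvalues. -/
theorem trace_conj_diagonal_mul {H U R : Matrix W W ℝ} (hH : H.transpose = H) (l m : W → ℝ) :
    (H * (U * Matrix.diagonal l * U.transpose) * H *
      (R * Matrix.diagonal m * R.transpose)).trace =
    ∑ i, ∑ j, l i * m j * ((U.transpose * H * R) i j) ^ 2 := by
  have h1 : (H * (U * Matrix.diagonal l * U.transpose) * H *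
      (R * Matrix.diagonal m * R.transpose)).trace =
      (Matrix.diagonal l * (U.transpose * H * R) * (Matrix.diagonal m *
        (U.transpose * H * R).transpose)).trace := by
    rw [Matrix.transpose_mul, Matrix.transpose_mul, hH, Matrix.transpose_transpose]
    have : H * (U * Matrix.diagonal l * U.transpose) * H *
      (R * Matrix.diagonal m * R.transpose) = (H * U) * (Matrix.diagonal l * U.transpose * H *
      R * Matrix.diagonal m * R.transpose) := by simp only [Matrix.mul_assoc]
    rw [this, Matrix.trace_mul_comm]
    simp only [Matrix.mul_assoc]
  rw [h1, Matrix.trace]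
  refine Finset.sum_congr rfl fun i _ => ?_
  rw [Matrix.diag_apply, Matrix.mul_apply]
  refine Finset.sum_congr rfl fun j _ => ?_
  rw [Matrix.diagonal_mul, Matrix.diagonal_mul, Matrix.transpose_apply]
  ring

/-- For nonnegative a, b the differences a^q - b^q and a^(2r-q) - b^(2r-q) have the same sign.
Evenness of 2r allows passing to absolute values. -/
theorem pow_mul_pow_add_le (r q : ℕ) (hq : q ≤ 2 * r) (x y : ℝ) :
    x ^ q * y ^ (2 * r - q) + x ^ (2 * r - q) * y ^ q ≤ x ^ (2 * r) + y ^ (2 * r) := by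
  have key : ∀ a b : ℝ, 0 ≤ a → 0 ≤ b →
      a ^ q * b ^ (2 * r - q) + a ^ (2 * r - q) * b ^ q ≤ a ^ (2 * r) + b ^ (2 * r) := by
    intro a b ha hb
    have h : 0 ≤ (a ^ q - b ^ q) * (a ^ (2 * r - q) - b ^ (2 * r - q)) := by
      rcases le_total a b with h | h
      · exact mul_nonneg_of_nonpos_of_nonpos (sub_nonpos.2 (pow_le_pow_left₀ ha h _))
          (sub_nonpos.2 (pow_le_pow_left₀ ha h _))
      · exact mul_nonneg (sub_nonneg.2 (pow_le_pow_left₀ hb h _))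
          (sub_nonneg.2 (pow_le_pow_left₀ hb h _))
    have e : ∀ z : ℝ, z ^ (2 * r) = z ^ q * z ^ (2 * r - q) := fun z => by
      rw [← pow_add, Nat.add_sub_cancel' hq]
    rw [e a, e b]
    nlinarith
  have := key |x| |y| (abs_nonneg _) (abs_nonneg _)
  have ev : Even (2 * r) := even_two_mul r
  rw [ev.pow_abs, ev.pow_abs] at this
  refine le_trans ?_ this
  rw [← abs_pow, ← abs_pow, ← abs_pow, ← abs_pow, ← abs_mul, ← abs_mul]
  exact add_le_add (le_abs_self _) (le_abs_self _)

theorem sum_pow_mul_pow_le (r : ℕ) (x y : ℝ) :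
    ∑ q ∈ Finset.range (2 * r + 1), x ^ q * y ^ (2 * r - q) ≤
      (2 * r + 1) / 2 * (x ^ (2 * r) + y ^ (2 * r)) := by
  have h1 : ∑ q ∈ Finset.range (2 * r + 1), x ^ q * y ^ (2 * r - q) =
      ∑ q ∈ Finset.range (2 * r + 1), x ^ (2 * r - q) * y ^ q := by
    rw [← Finset.sum_range_reflect]
    refine Finset.sum_congr rfl fun q hq => ?_
    have := Finset.mem_range.1 hq
    congr 2
    omega
  have h2 : ∑ q ∈ Finset.range (2 * r + 1),
      (x ^ q * y ^ (2 * r - q) + x ^ (2 * r - q) * y ^ q) ≤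
      ∑ q ∈ Finset.range (2 * r + 1), (x ^ (2 * r) + y ^ (2 * r)) :=
    Finset.sum_le_sum fun q hq => pow_mul_pow_add_le r q
      (by have := Finset.mem_range.1 hq; omega) x y
  rw [Finset.sum_add_distrib, ← h1, Finset.sum_const, Finset.card_range, nsmul_eq_mul] at h2
  push_cast at h2
  linarith

/-- A trace form of the inequality between geometric and arithmetic means. -/
theorem sum_trace_mul_pow_mul_pow_le {H S T : Matrix W W ℝ} (hH : H.IsHermitian)
    (hS : S.IsHermitian) (hT : T.IsHermitian) (r : ℕ) :
    ∑ q ∈ Finset.range (2 * r + 1), (H * S ^ q * H * T ^ (2 * r - q)).trace ≤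
      (2 * r + 1) / 2 * ((H * S ^ (2 * r) * H).trace + (H * H * T ^ (2 * r)).trace) := by
  have hH' : H.transpose = H := by
    rwa [Matrix.IsHermitian, Matrix.conjTranspose_eq_transpose_of_trivial] at hH
  obtain ⟨U, -, hU⟩ := hS.exists_pow_eq_conj_diagonal
  obtain ⟨R, -, hR⟩ := hT.exists_pow_eq_conj_diagonal
  have key : ∀ q s : ℕ, (H * S ^ q * H * T ^ s).trace = ∑ i, ∑ j,
      hS.eigenvalues i ^ q * hT.eigenvalues j ^ s * ((U.transpose * H * R) i j) ^ 2 := by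
    intro q s
    rw [hU, hR, trace_conj_diagonal_mul hH']
  have k1 := key (2 * r) 0
  have k2 := key 0 (2 * r)
  simp only [pow_zero, Matrix.mul_one] at k1 k2
  rw [k1, k2, ← Finset.sum_add_distrib, Finset.mul_sum]
  simp only [key]
  rw [Finset.sum_comm]
  refine Finset.sum_le_sum fun i _ => ?_
  rw [Finset.sum_comm, ← Finset.sum_add_distrib, Finset.mul_sum]
  refine Finset.sum_le_sum fun j _ => ?_
  rw [← Finset.sum_mul]
  have := mul_le_mul_of_nonneg_right
    (sum_pow_mul_pow_le r (hS.eigenvalues i) (hT.eigenvalues j))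
    (sq_nonneg ((U.transpose * H * R) i j))
  linarith

theorem pow_sub_pow_eq_sum {R : Type*} [Ring R] (a b : R) (n : ℕ) :
    a ^ n - b ^ n = ∑ q ∈ Finset.range n, a ^ q * (a - b) * b ^ (n - 1 - q) := by
  induction n with
  | zero => simp
  | succ n ih =>
    rw [Finset.sum_range_succ]
    have : ∑ q ∈ Finset.range n, a ^ q * (a - b) * b ^ (n + 1 - 1 - q) =
        (∑ q ∈ Finset.range n, a ^ q * (a - b) * b ^ (n - 1 - q)) * b := by
      rw [Finset.sum_mul]
      refine Finset.sum_congr rfl fun q hq => ?_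
      have := Finset.mem_range.1 hq
      rw [mul_assoc _ _ b, ← pow_succ]
      congr 2
      omega
    rw [this, ← ih]
    simp only [Nat.add_sub_cancel, Nat.sub_self, pow_zero, mul_one, pow_succ, sub_mul, mul_sub]
    abel

theorem trace_pow_two_mul {S : Matrix W W ℝ} (hS : S.IsHermitian) (r : ℕ) :
    (S ^ (2 * r)).trace = ∑ y, ∑ x, (S ^ r) x y ^ 2 := by
  have h : (S ^ r).transpose = S ^ r := by
    have := hS.pow r
    rwa [Matrix.IsHermitian, Matrix.conjTranspose_eq_transpose_of_trivial] at this
  rw [two_mul, pow_add, Matrix.trace]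
  refine Finset.sum_congr rfl fun y _ => ?_
  rw [Matrix.diag_apply, Matrix.mul_apply]
  refine Finset.sum_congr rfl fun x _ => ?_
  rw [sq, ← congrFun (congrFun h x) y, Matrix.transpose_apply]

/-- The trace is the squared Frobenius norm of H S^r; the bound `hD` is applied to each column of
S^r. -/
theorem trace_mul_mul_pow_le {H S : Matrix W W ℝ} (hH : H.IsHermitian) (hS : S.IsHermitian)
    (r : ℕ) (D : W → ℝ) (hD : ∀ x : W → ℝ, ∑ i, (H.mulVec x) i ^ 2 ≤ ∑ i, D i * x i ^ 2) :
    (H * H * S ^ (2 * r)).trace ≤ ∑ y, ∑ x, D x * (S ^ r) x y ^ 2 := by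
  have h : (S ^ r).transpose = S ^ r := by
    have := hS.pow r
    rwa [Matrix.IsHermitian, Matrix.conjTranspose_eq_transpose_of_trivial] at this
  have h' : H.transpose = H := by
    rwa [Matrix.IsHermitian, Matrix.conjTranspose_eq_transpose_of_trivial] at hH
  have e : (H * H * S ^ (2 * r)).trace = ((H * S ^ r).transpose * (H * S ^ r)).trace := by
    rw [Matrix.transpose_mul, h, h', two_mul, pow_add, ← Matrix.mul_assoc, Matrix.trace_mul_comm]
    simp only [Matrix.mul_assoc]
  rw [e, Matrix.trace]
  refine Finset.sum_le_sum fun y _ => ?_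
  rw [Matrix.diag_apply, Matrix.mul_apply]
  refine le_trans (le_of_eq ?_) (hD fun x => (S ^ r) x y)
  refine Finset.sum_congr rfl fun x _ => ?_
  rw [Matrix.transpose_apply, ← sq]
  rfl

theorem eigenvalue_pow_le_trace {S : Matrix W W ℝ} (hS : S.IsHermitian) {t : ℝ}
    (ht : t ∈ S.charpoly.roots) (r : ℕ) : t ^ (2 * r) ≤ (S ^ (2 * r)).trace := by
  obtain ⟨U, hU, h⟩ := hS.exists_pow_eq_conj_diagonal
  have e : (S ^ (2 * r)).trace = ∑ i, hS.eigenvalues i ^ (2 * r) := by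
    rw [h, Matrix.trace_mul_comm, ← Matrix.mul_assoc, hU, Matrix.one_mul, Matrix.trace_diagonal]
  rw [hS.roots_charpoly_eq_eigenvalues] at ht
  obtain ⟨i, -, rfl⟩ := Multiset.mem_map.1 ht
  rw [e]
  exact Finset.single_le_sum (f := fun i => hS.eigenvalues i ^ (2 * r))
    (fun i _ => (even_two_mul r).pow_nonneg _) (Finset.mem_univ i)

end Trace

/-! ### Finite product distributions -/

section Product

variable {ι : Type*} [Fintype ι] [DecidableEq ι] {A : ι → Type*} [∀ i, Fintype (A i)]

theorem sum_prod_eq_one {p : ∀ i, A i → ℝ} (hp : ∀ i, ∑ a, p i a = 1) :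
    ∑ m : ∀ i, A i, ∏ i, p i (m i) = 1 := by
  rw [← Fintype.prod_sum]
  simp [hp]

/-- Resampling one coordinate of a product distribution gives an exchangeable pair. -/
theorem sum_prod_mul_swap (p : ∀ i, A i → ℝ) (i : ι) (f : (∀ i, A i) → A i → ℝ) :
    ∑ m : ∀ i, A i, ∑ a, (∏ j, p j (m j)) * p i a * f m a =
      ∑ m : ∀ i, A i, ∑ a, (∏ j, p j (m j)) * p i a * f (Function.update m i a) (m i) := by
  rw [← Fintype.sum_prod_type', ← Fintype.sum_prod_type']
  let e : (∀ i, A i) × A i ≃ (∀ i, A i) × A i :=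
    { toFun := fun x => (Function.update x.1 i x.2, x.1 i)
      invFun := fun x => (Function.update x.1 i x.2, x.1 i)
      left_inv := fun x => by simp
      right_inv := fun x => by simp }
  rw [← Equiv.sum_comp e]
  refine Finset.sum_congr rfl fun x _ => ?_
  change (∏ j, p j (Function.update x.1 i x.2 j)) * p i (x.1 i) *
    f (Function.update x.1 i x.2) (x.1 i) = _
  congr 1
  rw [← Finset.mul_prod_erase _ _ (Finset.mem_univ i),
    ← Finset.mul_prod_erase _ (fun j => p j (x.1 j)) (Finset.mem_univ i)]
  have : ∏ j ∈ Finset.univ.erase i, p j (Function.update x.1 i x.2 j) =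
      ∏ j ∈ Finset.univ.erase i, p j (x.1 j) :=
    Finset.prod_congr rfl fun j hj => by
      rw [Function.update_of_ne (Finset.ne_of_mem_erase hj)]
  rw [this, Function.update_self]
  ring

end Product

/-! ### Moments and tails of sums of independent centred matrices -/

section Moments

variable {ι : Type*} [Fintype ι] [DecidableEq ι] {A : ι → Type*} [∀ i, Fintype (A i)]
  {W : Type*} [Fintype W] [DecidableEq W]

omit [DecidableEq W] in
theorem sum_mulVec_sub_sq_le {X Y : Matrix W W ℝ} {D : W → ℝ}
    (hX : ∀ x : W → ℝ, ∑ i, (X.mulVec x) i ^ 2 ≤ ∑ i, D i * x i ^ 2)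
    (hY : ∀ x : W → ℝ, ∑ i, (Y.mulVec x) i ^ 2 ≤ ∑ i, D i * x i ^ 2) (x : W → ℝ) :
    ∑ i, ((X - Y).mulVec x) i ^ 2 ≤ ∑ i, (4 * D i) * x i ^ 2 := by
  have h1 : ∑ i, ((X - Y).mulVec x) i ^ 2 ≤
      ∑ i, (2 * (X.mulVec x) i ^ 2 + 2 * (Y.mulVec x) i ^ 2) := by
    refine Finset.sum_le_sum fun i _ => ?_
    rw [Matrix.sub_mulVec, Pi.sub_apply]
    nlinarith [sq_nonneg (X.mulVec x i + Y.mulVec x i)]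
  rw [Finset.sum_add_distrib, ← Finset.mul_sum, ← Finset.mul_sum] at h1
  have h2 : ∑ i, (4 * D i) * x i ^ 2 = 4 * ∑ i, D i * x i ^ 2 := by
    rw [Finset.mul_sum]
    exact Finset.sum_congr rfl fun i _ => by ring
  linarith [hX x, hY x]

variable {p : ∀ i, A i → ℝ} {X : ∀ i, A i → Matrix W W ℝ} {D : ι → W → ℝ}

omit [DecidableEq ι] [∀ i, Fintype (A i)] [Fintype W] [DecidableEq W] in
theorem isHermitian_sum (hX : ∀ i a, (X i a).IsHermitian) (m : ∀ i, A i) :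
    (∑ i, X i (m i)).IsHermitian := by
  rw [Matrix.IsHermitian, Matrix.conjTranspose_sum]
  exact Finset.sum_congr rfl fun i _ => hX i (m i)

/-- Exchangeable pair: let S' be S with summand i resampled. Centring and swapping turn twice the
left side into the mean of tr((S - S')(S^(2r+1) - S'^(2r+1))), which telescopes into traces
controlled by the mean inequality. -/
theorem sum_weight_trace_mul_pow_le (hp0 : ∀ i a, 0 ≤ p i a) (hp : ∀ i, ∑ a, p i a = 1)
    (hX : ∀ i a, (X i a).IsHermitian) (hmean : ∀ i, ∑ a, p i a • X i a = 0)
    (hD : ∀ i a (x : W → ℝ), ∑ j, ((X i a).mulVec x) j ^ 2 ≤ ∑ j, D i j * x j ^ 2)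
    (i : ι) (r : ℕ) :
    ∑ m : ∀ i, A i, (∏ j, p j (m j)) *
      (X i (m i) * (∑ j, X j (m j)) ^ (2 * r + 1)).trace ≤
    2 * (2 * r + 1) * ∑ m : ∀ i, A i, (∏ j, p j (m j)) *
      ∑ y, ∑ x, D i x * ((∑ j, X j (m j)) ^ r) x y ^ 2 := by
  set S : (∀ i, A i) → Matrix W W ℝ := fun m => ∑ j, X j (m j) with hSdef
  have hS : ∀ m, (S m).IsHermitian := isHermitian_sum hX
  set w : (∀ i, A i) → ℝ := fun m => ∏ j, p j (m j) with hw
  have hw0 : ∀ m, 0 ≤ w m := fun m => Finset.prod_nonneg fun j _ => hp0 j _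
  have hsub : ∀ m a, S m - S (Function.update m i a) = X i (m i) - X i a := by
    intro m a
    simp only [hSdef, ← Finset.sum_sub_distrib]
    rw [Finset.sum_eq_single i]
    · simp
    · intro j _ hj
      rw [Function.update_of_ne hj, sub_self]
    · simp
  set φ : (∀ i, A i) → ℝ := fun m => ∑ y, ∑ x, D i x * (S m ^ r) x y ^ 2 with hφ
  have const : ∀ f : (∀ i, A i) → ℝ, ∑ m, w m * f m = ∑ m, ∑ a, w m * p i a * f m := by
    intro f
    refine Finset.sum_congr rfl fun m _ => ?_
    rw [← Finset.sum_mul, ← Finset.mul_sum, hp, mul_one]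
  -- The independent copy `X i a` has mean zero given m, so subtracting it changes nothing.
  have E1 : ∑ m, w m * (X i (m i) * S m ^ (2 * r + 1)).trace =
      ∑ m, ∑ a, w m * p i a * ((X i (m i) - X i a) * S m ^ (2 * r + 1)).trace := by
    refine Finset.sum_congr rfl fun m _ => ?_
    have h0 : ∑ a, p i a * (X i a * S m ^ (2 * r + 1)).trace = 0 := by
      have : ∑ a, p i a * (X i a * S m ^ (2 * r + 1)).trace =
          ((∑ a, p i a • X i a) * S m ^ (2 * r + 1)).trace := by
        rw [Finset.sum_mul, Matrix.trace_sum]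
        refine Finset.sum_congr rfl fun a _ => ?_
        rw [Matrix.smul_mul, Matrix.trace_smul, smul_eq_mul]
      rw [this, hmean, Matrix.zero_mul, Matrix.trace_zero]
    simp only [Matrix.sub_mul, Matrix.trace_sub, mul_sub, Finset.sum_sub_distrib]
    simp only [mul_assoc]
    rw [← Finset.mul_sum, ← Finset.mul_sum, h0, ← Finset.sum_mul, hp]
    ring
  have E2 : ∑ m, ∑ a, w m * p i a * ((X i (m i) - X i a) * S m ^ (2 * r + 1)).trace =
      ∑ m, ∑ a, w m * p i a *
        ((X i a - X i (m i)) * S (Function.update m i a) ^ (2 * r + 1)).trace := by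
    have := sum_prod_mul_swap p i fun m a => ((X i (m i) - X i a) * S m ^ (2 * r + 1)).trace
    simpa only [Function.update_self] using this
  have E3 : ∀ m a, ((X i (m i) - X i a) * S m ^ (2 * r + 1)).trace +
      ((X i a - X i (m i)) * S (Function.update m i a) ^ (2 * r + 1)).trace ≤
      (2 * r + 1) / 2 * (4 * φ m + 4 * φ (Function.update m i a)) := by
    intro m a
    have hH : (X i (m i) - X i a).IsHermitian := (hX _ _).sub (hX _ _)
    have hHD := sum_mulVec_sub_sq_le (hD i (m i)) (hD i a)
    have b : ∀ m', ((X i (m i) - X i a) * (X i (m i) - X i a) * S m' ^ (2 * r)).trace ≤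
        4 * φ m' := by
      intro m'
      refine (trace_mul_mul_pow_le hH (hS m') r _ hHD).trans (le_of_eq ?_)
      simp only [hφ, Finset.mul_sum, mul_assoc]
    have g := sum_trace_mul_pow_mul_pow_le hH (hS m) (hS (Function.update m i a)) r
    have b1 := b m
    have b2 := b (Function.update m i a)
    have c : ((X i (m i) - X i a) * S m ^ (2 * r) * (X i (m i) - X i a)).trace =
        ((X i (m i) - X i a) * (X i (m i) - X i a) * S m ^ (2 * r)).trace := by
      rw [Matrix.trace_mul_comm, Matrix.mul_assoc]
    rw [c] at g
    have l : ((X i (m i) - X i a) * S m ^ (2 * r + 1)).trace +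
      ((X i a - X i (m i)) * S (Function.update m i a) ^ (2 * r + 1)).trace =
      ((X i (m i) - X i a) * (S m ^ (2 * r + 1) -
        S (Function.update m i a) ^ (2 * r + 1))).trace := by
      rw [← Matrix.trace_add]
      congr 1
      simp only [Matrix.sub_mul, Matrix.mul_sub]
      abel
    rw [l, pow_sub_pow_eq_sum, hsub, Matrix.mul_sum, Matrix.trace_sum]
    simp only [Nat.add_sub_cancel, ← Matrix.mul_assoc]
    refine g.trans (mul_le_mul_of_nonneg_left (add_le_add b1 b2) (by positivity))
  -- S and S' have the same distribution, so both halves of the bound have equal mean.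
  have E4 : ∑ m, w m * φ m = ∑ m, ∑ a, w m * p i a * φ (Function.update m i a) := by
    rw [const]
    exact sum_prod_mul_swap p i fun m _ => φ m
  have E5 : ∑ m, ∑ a, w m * p i a * (((X i (m i) - X i a) * S m ^ (2 * r + 1)).trace +
      ((X i a - X i (m i)) * S (Function.update m i a) ^ (2 * r + 1)).trace) ≤
      ∑ m, ∑ a, w m * p i a * ((2 * r + 1) / 2 * (4 * φ m + 4 * φ (Function.update m i a))) :=
    Finset.sum_le_sum fun m _ => Finset.sum_le_sum fun a _ =>
      mul_le_mul_of_nonneg_left (E3 m a) (mul_nonneg (hw0 m) (hp0 i a))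
  have E6 : ∑ m, ∑ a, w m * p i a * ((2 * r + 1) / 2 * (4 * φ m + 4 * φ (Function.update m i a)))
      = 4 * (2 * r + 1) * ∑ m, w m * φ m := by
    have : ∀ m a, w m * p i a * ((2 * r + 1) / 2 * (4 * φ m + 4 * φ (Function.update m i a))) =
        2 * (2 * r + 1) * (w m * p i a * φ m) +
        2 * (2 * r + 1) * (w m * p i a * φ (Function.update m i a)) := fun m a => by ring
    simp only [this, Finset.sum_add_distrib, ← Finset.mul_sum]
    rw [← E4, ← const]
    ring
  simp only [mul_add, Finset.sum_add_distrib] at E5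
  simp only [mul_add, Finset.sum_add_distrib] at E6
  rw [← E2, ← E1, E6] at E5
  linarith

/-- Moment bound for a sum of independent centred symmetric matrices whose squares are bounded by
diagonal matrices. -/
theorem sum_weight_trace_pow_le (hp0 : ∀ i a, 0 ≤ p i a) (hp : ∀ i, ∑ a, p i a = 1)
    (hX : ∀ i a, (X i a).IsHermitian) (hmean : ∀ i, ∑ a, p i a • X i a = 0)
    (hD : ∀ i a (x : W → ℝ), ∑ j, ((X i a).mulVec x) j ^ 2 ≤ ∑ j, D i j * x j ^ 2)
    {v : ℝ} (hv0 : 0 ≤ v) (hv : ∀ x, ∑ i, D i x ≤ v) (r : ℕ) :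
    ∑ m : ∀ i, A i, (∏ j, p j (m j)) * ((∑ j, X j (m j)) ^ (2 * r)).trace ≤
      (4 * r * v) ^ r * Fintype.card W := by
  induction r with
  | zero =>
    simp [← Finset.sum_mul, sum_prod_eq_one hp]
  | succ r ih =>
    -- One factor S is peeled off and expanded into its summands.
    have h1 : ∑ m : ∀ i, A i, (∏ j, p j (m j)) * ((∑ j, X j (m j)) ^ (2 * (r + 1))).trace =
        ∑ i, ∑ m : ∀ i, A i, (∏ j, p j (m j)) *
          (X i (m i) * (∑ j, X j (m j)) ^ (2 * r + 1)).trace := by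
      rw [Finset.sum_comm]
      refine Finset.sum_congr rfl fun m _ => ?_
      rw [← Finset.mul_sum, ← Matrix.trace_sum, ← Finset.sum_mul, ← pow_succ']
      rfl
    have h2 : ∑ i, ∑ m : ∀ i, A i, (∏ j, p j (m j)) *
          (X i (m i) * (∑ j, X j (m j)) ^ (2 * r + 1)).trace ≤
        ∑ i, 2 * (2 * r + 1) * ∑ m : ∀ i, A i, (∏ j, p j (m j)) *
          ∑ y, ∑ x, D i x * ((∑ j, X j (m j)) ^ r) x y ^ 2 :=
      Finset.sum_le_sum fun i _ => sum_weight_trace_mul_pow_le hp0 hp hX hmean hD i r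
    have h3 : ∑ i, 2 * (2 * r + 1) * ∑ m : ∀ i, A i, (∏ j, p j (m j)) *
          ∑ y, ∑ x, D i x * ((∑ j, X j (m j)) ^ r) x y ^ 2 ≤
        2 * (2 * r + 1) * ∑ m : ∀ i, A i, (∏ j, p j (m j)) *
          (v * ((∑ j, X j (m j)) ^ (2 * r)).trace) := by
      rw [← Finset.mul_sum, Finset.sum_comm]
      refine mul_le_mul_of_nonneg_left (Finset.sum_le_sum fun m _ => ?_) (by positivity)
      rw [← Finset.mul_sum]
      refine mul_le_mul_of_nonneg_left ?_ (Finset.prod_nonneg fun j _ => hp0 j _)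
      rw [trace_pow_two_mul (isHermitian_sum hX m), Finset.mul_sum, Finset.sum_comm]
      refine Finset.sum_le_sum fun y _ => ?_
      rw [Finset.mul_sum, Finset.sum_comm]
      refine Finset.sum_le_sum fun x _ => ?_
      rw [← Finset.sum_mul]
      exact mul_le_mul_of_nonneg_right (hv x) (sq_nonneg _)
    have h4 : ∑ m : ∀ i, A i, (∏ j, p j (m j)) * (v * ((∑ j, X j (m j)) ^ (2 * r)).trace) ≤
        v * ((4 * r * v) ^ r * Fintype.card W) := by
      refine le_trans (le_of_eq ?_) (mul_le_mul_of_nonneg_left ih hv0)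
      rw [Finset.mul_sum]
      exact Finset.sum_congr rfl fun m _ => by ring
    rw [h1]
    refine h2.trans (h3.trans ((mul_le_mul_of_nonneg_left h4 (by positivity)).trans ?_))
    have h5 : (4 * r * v) ^ r ≤ (4 * (r + 1) * v) ^ r := by
      gcongr
      linarith
    -- The induction closes because 2(2r+1) ≤ 4(r+1).
    calc 2 * (2 * (r : ℝ) + 1) * (v * ((4 * r * v) ^ r * Fintype.card W))
        ≤ (4 * (r + 1) * v) * ((4 * (r + 1) * v) ^ r * Fintype.card W) := by
          rw [← mul_assoc]
          refine mul_le_mul ?_ (mul_le_mul_of_nonneg_right h5 (by positivity)) (by positivity)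
            (by positivity)
          nlinarith
      _ = _ := by push_cast; ring

/-- Tail bound for the eigenvalues of a sum of independent centred symmetric matrices. -/
theorem sum_weight_exists_root_le (hp0 : ∀ i a, 0 ≤ p i a) (hp : ∀ i, ∑ a, p i a = 1)
    (hX : ∀ i a, (X i a).IsHermitian) (hmean : ∀ i, ∑ a, p i a • X i a = 0)
    (hD : ∀ i a (x : W → ℝ), ∑ j, ((X i a).mulVec x) j ^ 2 ≤ ∑ j, D i j * x j ^ 2)
    {v : ℝ} (hv0 : 0 < v) (hv : ∀ x, ∑ i, D i x ≤ v) {δ : ℝ} (hδ0 : 0 < δ) (hδ1 : δ < 1)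
    (hW : 0 < Fintype.card W) (s : Finset (∀ i, A i))
    (hs : ∀ m ∈ s, ∃ t ∈ (∑ j, X j (m j)).charpoly.roots,
      16 * √(v * Real.log (2 * Fintype.card W / δ)) < |t|) :
    ∑ m ∈ s, ∏ j, p j (m j) ≤ δ := by
  set N : ℝ := (Fintype.card W : ℝ) with hN
  have hN1 : 1 ≤ N := by rw [hN]; exact_mod_cast hW
  set L := Real.log (2 * N / δ) with hL
  -- A lower bound on L is needed so that rounding up to r costs only a constant factor.
  have hL2 : 0.69 < L := by
    have : Real.log 2 ≤ L := by
      apply Real.log_le_log (by norm_num)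
      rw [le_div_iff₀ hδ0]
      nlinarith
    linarith [Real.log_two_gt_d9]
  set r := ⌈L⌉₊ with hr
  have hr1 : L ≤ r := Nat.le_ceil L
  have hr2 : (r : ℝ) < L + 1 := Nat.ceil_lt_add_one (by linarith)
  have hpos : 0 < (256 * v * L) ^ r := by positivity
  -- Markov's inequality: each bad outcome contributes at least (16² v L)^r to the trace moment.
  have h1 : ∀ m ∈ s, (256 * v * L) ^ r ≤ ((∑ j, X j (m j)) ^ (2 * r)).trace := by
    intro m hm
    obtain ⟨t, ht, hlt⟩ := hs m hm
    refine le_trans ?_ (eigenvalue_pow_le_trace (isHermitian_sum hX m) ht r)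
    rw [pow_mul]
    refine pow_le_pow_left₀ (by positivity) ?_ r
    have := mul_self_le_mul_self (by positivity) hlt.le
    rw [abs_mul_abs_self] at this
    have h2 := Real.mul_self_sqrt (show 0 ≤ v * L by positivity)
    nlinarith
  have h2 : (256 * v * L) ^ r * ∑ m ∈ s, ∏ j, p j (m j) ≤ (4 * r * v) ^ r * N := by
    refine le_trans ?_ (sum_weight_trace_pow_le hp0 hp hX hmean hD hv0.le hv r)
    rw [Finset.mul_sum]
    refine le_trans (Finset.sum_le_sum fun m hm => ?_) (Finset.sum_le_univ_sum_of_nonneg fun m => ?_)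
    · rw [mul_comm]
      exact mul_le_mul_of_nonneg_left (h1 m hm) (Finset.prod_nonneg fun j _ => hp0 j _)
    · refine mul_nonneg (Finset.prod_nonneg fun j _ => hp0 j _) ?_
      rw [trace_pow_two_mul (isHermitian_sum hX m)]
      positivity
  -- The constant 16 leaves room here: 4r < 4(L+1) is well below 256L/3, and 1/3 ≤ 1/e.
  have h3 : (4 * r * v) ^ r ≤ (256 * v * L) ^ r * Real.exp (-1) ^ r := by
    rw [← mul_pow]
    refine pow_le_pow_left₀ (by positivity) ?_ r
    have he : (1 / 3 : ℝ) ≤ Real.exp (-1) := by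
      rw [Real.exp_neg, ← one_div]
      exact one_div_le_one_div_of_le (Real.exp_pos _) (by linarith [Real.exp_one_lt_d9])
    have : 256 * v * L * (1 / 3) ≤ 256 * v * L * Real.exp (-1) :=
      mul_le_mul_of_nonneg_left he (by positivity)
    nlinarith
  have h4 : Real.exp (-1) ^ r * N ≤ δ := by
    have : Real.exp (-1) ^ r ≤ Real.exp (-L) := by
      rw [← Real.exp_nat_mul]
      exact Real.exp_le_exp.2 (by linarith)
    have e : Real.exp (-L) = δ / (2 * N) := by
      rw [Real.exp_neg, hL, Real.exp_log (by positivity), inv_div]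
    calc Real.exp (-1) ^ r * N ≤ δ / (2 * N) * N := by
          rw [← e]
          gcongr
      _ = δ / 2 := by field_simp
      _ ≤ δ := by linarith
  refine le_of_mul_le_mul_left (h2.trans ?_) hpos
  calc (4 * r * v) ^ r * N ≤ (256 * v * L) ^ r * Real.exp (-1) ^ r * N := by gcongr
    _ = (256 * v * L) ^ r * (Real.exp (-1) ^ r * N) := by ring
    _ ≤ _ := by gcongr

end Moments


/-! ### Factoring characteristic polynomials -/

section Charpoly

open Polynomial

variable {m n : Type*} [Fintype m] [DecidableEq m] [Fintype n] [DecidableEq n]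

/-- Since SB = 0, (X - S)(X - B) = X(X - S - B); take determinants. -/
theorem charpoly_add_mul_of_mul_eq_zero {S B : Matrix m m ℝ} (h : S * B = 0) :
    X ^ Fintype.card m * (S + B).charpoly = S.charpoly * B.charpoly := by
  have e : S.charmatrix * B.charmatrix = (X : ℝ[X]) • (S + B).charmatrix := by
    have h' : C.mapMatrix S * C.mapMatrix B = (0 : Matrix m m ℝ[X]) := by
      rw [← map_mul, h, map_zero]
    rw [Matrix.charmatrix, Matrix.charmatrix, Matrix.charmatrix, sub_mul, mul_sub, mul_sub, h',
      map_add]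
    have c : ∀ Z : Matrix m m ℝ[X], Z * Matrix.scalar m X = (X : ℝ[X]) • Z := fun Z => by
      ext i j
      simp [mul_comm]
    have c' : ∀ Z : Matrix m m ℝ[X], Matrix.scalar m X * Z = (X : ℝ[X]) • Z := fun Z => by
      ext i j
      simp
    rw [c', c', c]
    simp only [smul_sub, smul_add]
    abel
  rw [Matrix.charpoly, Matrix.charpoly, Matrix.charpoly, ← Matrix.det_mul, e, Matrix.det_smul]

/-- If `S P = 0`, the spectrum of `S + P Q` consists of those of `S` and `Q P`, up to zeros. -/
theorem charpoly_add_mul_mul_X_pow {S : Matrix m m ℝ} {P : Matrix m n ℝ} {Q : Matrix n m ℝ}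
    (h : S * P = 0) :
    X ^ Fintype.card n * (S + P * Q).charpoly = S.charpoly * (Q * P).charpoly := by
  have h1 := charpoly_add_mul_of_mul_eq_zero (S := S) (B := P * Q)
    (by rw [← Matrix.mul_assoc, h, Matrix.zero_mul])
  have h2 := Matrix.charpoly_mul_comm' P Q
  refine mul_left_cancel₀ (pow_ne_zero (Fintype.card m) (X_ne_zero (R := ℝ))) ?_
  linear_combination X ^ Fintype.card n * h1 + S.charpoly * h2

theorem charpoly_one_sub (M : Matrix m m ℝ) :
    (1 - M).charpoly = (-M).charpoly.comp (X - C 1) := by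
  have := Matrix.charpoly_sub_scalar (-M) (-1)
  have e : -M - Matrix.scalar m (-1 : ℝ) = 1 - M := by
    rw [map_neg, map_one]; abel
  rw [e] at this
  rw [this, map_neg, sub_eq_add_neg]

theorem charpoly_one_sub_add_mul {S : Matrix m m ℝ} {P : Matrix m n ℝ} {Q : Matrix n m ℝ}
    (h : S * P = 0) :
    (X - C 1) ^ Fintype.card n * (1 - (S + P * Q)).charpoly =
      (1 - S).charpoly * (1 - Q * P).charpoly := by
  have := charpoly_add_mul_mul_X_pow (S := -S) (P := P) (Q := -Q) (by rw [Matrix.neg_mul, h, neg_zero])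
  rw [charpoly_one_sub, charpoly_one_sub, charpoly_one_sub, ← mul_comp, ← Matrix.neg_mul, ← this,
    mul_comp, X_pow_comp, Matrix.mul_neg, neg_add]

theorem one_sub_mem_roots_charpoly {M : Matrix m m ℝ} {t : ℝ} (h : t ∈ (1 - M).charpoly.roots) :
    1 - t ∈ M.charpoly.roots := by
  rw [mem_roots (Matrix.charpoly_monic _).ne_zero, IsRoot.def, Matrix.eval_charpoly] at h ⊢
  have : Matrix.scalar m (1 - t) - M = -(Matrix.scalar m t - (1 - M)) := by
    rw [map_sub, map_one]; abel
  rw [this, Matrix.det_neg, h, mul_zero]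

/-- The factor `p` only adds roots on the left, so the auxiliary zeros (or ones) in the spectral
identities are harmless to the multiset difference. -/
theorem roots_sub_le_of_mul_eq {p q r s : ℝ[X]} (h : p * q = r * s) (h0 : p * q ≠ 0) :
    q.roots - s.roots ≤ r.roots := by
  rw [tsub_le_iff_right, ← roots_mul (h ▸ h0), ← h, roots_mul h0]
  exact le_add_self

end Charpoly

/-! ### Matchings, lifts and the centred blocks -/

section Lift

variable {V : Type*} {k : ℕ}

theorem EdgeMatching.eq_of_mem_pairs {e : Sym2 V} (a : EdgeMatching k e) {x y : V × Fin k}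
    (h : s(x, y) ∈ a.pairs) : e = s(x.1, y.1) := by
  induction e using Sym2.ind with
  | _ v w =>
  obtain ⟨f, hf, hp⟩ := a.isMatching v w rfl
  rw [hp] at h
  obtain ⟨z, hz, hzx⟩ := h
  have h2 : f z ∈ copies k w := hf.mapsTo hz
  have hz : z.1 = v := hz
  have h2 : (f z).1 = w := h2
  rcases Sym2.eq_iff.1 hzx with ⟨rfl, rfl⟩ | ⟨rfl, rfl⟩
  · rw [hz, h2]
  · rw [hz, h2, Sym2.eq_swap]

theorem EdgeMatching.exists_perm {e : Sym2 V} (a : EdgeMatching k e) {v w : V} (he : s(v, w) = e)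
    (hne : v ≠ w) : ∃ σ : Equiv.Perm (Fin k), ∀ l r, s((v, l), (w, r)) ∈ a.pairs ↔ σ l = r := by
  obtain ⟨f, hf, hp⟩ := a.isMatching v w he.symm
  have hfw : ∀ l, (f (v, l)).1 = w := fun l => hf.mapsTo (show (v, l) ∈ copies k v from rfl)
  have hinj : Function.Injective fun l => (f (v, l)).2 := by
    intro l l' h
    have := hf.injOn (show (v, l) ∈ copies k v from rfl) (show (v, l') ∈ copies k v from rfl)
      (Prod.ext ((hfw l).trans (hfw l').symm) h)
    exact (Prod.ext_iff.1 this).2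
  refine ⟨Equiv.ofBijective _ (Finite.injective_iff_bijective.1 hinj), fun l r => ?_⟩
  rw [Equiv.ofBijective_apply, hp]
  constructor
  · rintro ⟨z, hz, hzx⟩
    rcases Sym2.eq_iff.1 hzx with ⟨rfl, h⟩ | ⟨rfl, -⟩
    · rw [h]
    · exact absurd hz (Ne.symm hne)
  · intro h
    refine ⟨(v, l), rfl, ?_⟩
    exact congrArg (fun z => s((v, l), z)) (Prod.ext (hfw l) h)

theorem EdgeMatching.pairs_injective (e : Sym2 V) :
    Function.Injective (EdgeMatching.pairs : EdgeMatching k e → _) := by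
  rintro ⟨p, hp⟩ ⟨q, hq⟩ h
  congr

instance [Finite V] (e : Sym2 V) : Finite (EdgeMatching k e) :=
  Finite.of_injective _ (EdgeMatching.pairs_injective e)

theorem kLift_adj_iff (G : SimpleGraph V) (M : (e : G.edgeSet) → EdgeMatching k (e : Sym2 V))
    (x y : V × Fin k) : (kLift G k M).Adj x y ↔
      ∃ h : G.Adj x.1 y.1, s(x, y) ∈ (M ⟨s(x.1, y.1), G.mem_edgeSet.2 h⟩).pairs := by
  rw [kLift, SimpleGraph.fromEdgeSet_adj, Set.mem_iUnion]
  constructor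
  · rintro ⟨⟨⟨e, he⟩, h⟩, -⟩
    obtain rfl := (M ⟨e, he⟩).eq_of_mem_pairs h
    exact ⟨G.mem_edgeSet.1 he, h⟩
  · rintro ⟨h, hm⟩
    exact ⟨⟨_, hm⟩, fun hxy => h.ne (congrArg Prod.fst hxy)⟩

/-- The adjacency matrix with rows and columns scaled by `c`. -/
def scaledAdj {W : Type*} (c : W → ℝ) (H : SimpleGraph W)
    [DecidableRel H.Adj] : Matrix W W ℝ := fun x y => c x * c y * H.adjMatrix ℝ x y

open Classical in
/-- The scaled centred contribution of a matching of the copies of an edge to the adjacency matrix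
of a lift. -/
noncomputable def matchingBlock [DecidableEq V] (c : V → ℝ) {e : Sym2 V} (a : EdgeMatching k e) :
    Matrix (V × Fin k) (V × Fin k) ℝ := fun x y =>
  if s(x.1, y.1) = e then c x.1 * c y.1 * ((if s(x, y) ∈ a.pairs then 1 else 0) - 1 / (k : ℝ))
  else 0

/-- The matrix of a map that sends copies of a vertex to the vertex. -/
def copyMatrix (V : Type*) [DecidableEq V] (k : ℕ) : Matrix (V × Fin k) V ℝ :=
  fun x v => if x.1 = v then 1 else 0

/-- The scaled adjacency matrix averaged over copies of vertices. -/
noncomputable def avgMatrix (c : V → ℝ) (G : SimpleGraph V) [DecidableRel G.Adj] (k : ℕ) :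
    Matrix V (V × Fin k) ℝ := fun v x => scaledAdj c G v x.1 / k

theorem isHermitian_matchingBlock [DecidableEq V] (c : V → ℝ) {e : Sym2 V} (a : EdgeMatching k e) :
    (matchingBlock c a).IsHermitian := by
  classical
  ext x y
  have h1 : s(y.1, x.1) = s(x.1, y.1) := Sym2.eq_swap
  have h2 : s(y, x) ∈ a.pairs ↔ s(x, y) ∈ a.pairs := by rw [Sym2.eq_swap]
  rw [Matrix.conjTranspose_apply, star_trivial, matchingBlock, matchingBlock, h1, if_congr h2 rfl rfl,
    mul_comm (c y.1)]

variable [Fintype V] [DecidableEq V]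

-- On the copies of one endpoint, a block is a permutation minus the mean, times the scaling.
omit [Fintype V] in
theorem sum_matchingBlock_mul_fin (c : V → ℝ) {e : Sym2 V} (he : ¬ e.IsDiag)
    (a : EdgeMatching k e) {v w : V} (h : s(v, w) = e) :
    ∃ σ : Equiv.Perm (Fin k), ∀ (l : Fin k) (g : Fin k → ℝ),
      ∑ r, matchingBlock c a (v, l) (w, r) * g r = c v * c w * (g (σ l) - (∑ r, g r) / k) := by
  have hne : v ≠ w := by
    rintro rfl
    exact he (h ▸ Sym2.mk_isDiag_iff.2 rfl)
  obtain ⟨σ, hσ⟩ := a.exists_perm h hne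
  refine ⟨σ, fun l g => ?_⟩
  have : ∀ r, matchingBlock c a (v, l) (w, r) * g r =
      c v * c w * ((if σ l = r then g r else 0) - g r / k) := by
    intro r
    simp only [matchingBlock, if_pos h, hσ]
    split_ifs <;> ring
  simp only [this]
  rw [← Finset.mul_sum, Finset.sum_sub_distrib, Finset.sum_ite_eq, if_pos (Finset.mem_univ _),
    Finset.sum_div]

theorem matchingBlock_mul_copyMatrix (hk : 1 ≤ k) (c : V → ℝ) {e : Sym2 V} (he : ¬ e.IsDiag)
    (a : EdgeMatching k e) : matchingBlock c a * copyMatrix V k = 0 := by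
  ext ⟨v, l⟩ w
  rw [Matrix.mul_apply, Fintype.sum_prod_type, Finset.sum_eq_single w]
  · by_cases h : s(v, w) = e
    · obtain ⟨σ, hσ⟩ := sum_matchingBlock_mul_fin c he a h
      have := hσ l fun _ => 1
      have hk' : (k : ℝ) ≠ 0 := by positivity
      simpa [copyMatrix, hk'] using this
    · simp [matchingBlock, h]
  · intro u _ hu
    simp [copyMatrix, hu]
  · simp

theorem sum_sq_sub_mean_le (hk : 1 ≤ k) (g : Fin k → ℝ) :
    ∑ r, (g r - (∑ r, g r) / k) ^ 2 ≤ ∑ r, g r ^ 2 := by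
  have hk' : (0 : ℝ) < k := by positivity
  set s := ∑ r, g r with hs
  have : ∀ r, (g r - s / k) ^ 2 = g r ^ 2 - 2 * (s / k) * g r + (s / k) ^ 2 := fun r => by ring
  simp only [this, Finset.sum_add_distrib, Finset.sum_sub_distrib, ← Finset.mul_sum, ← hs]
  simp only [Finset.sum_const, Finset.card_univ, Fintype.card_fin, nsmul_eq_mul]
  have e : 2 * (s / k) * s = 2 * (s ^ 2 / k) := by ring
  have e' : (k : ℝ) * (s / k) ^ 2 = s ^ 2 / k := by field_simp
  have : 0 ≤ s ^ 2 / k := by positivity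
  rw [e, e']
  linarith

/-- Each endpoint has one partner in e, so no cross terms occur; permuting preserves the sum of
squares, and removing the mean does not increase it. -/
theorem sum_sq_matchingBlock_mulVec_le (hk : 1 ≤ k) (c : V → ℝ) {e : Sym2 V} (he : ¬ e.IsDiag)
    (a : EdgeMatching k e) (x : V × Fin k → ℝ) :
    ∑ j, ((matchingBlock c a).mulVec x) j ^ 2 ≤
      ∑ j : V × Fin k, (∑ v, if s(v, j.1) = e then (c v * c j.1) ^ 2 else 0) * x j ^ 2 := by
  have h1 : ∀ v l, ((matchingBlock c a).mulVec x) (v, l) ^ 2 =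
      ∑ w, (∑ r, matchingBlock c a (v, l) (w, r) * x (w, r)) ^ 2 := by
    intro v l
    rw [Matrix.mulVec, dotProduct, Fintype.sum_prod_type]
    by_cases h : ∃ w, s(v, w) = e
    · obtain ⟨w, hw⟩ := h
      have hz : ∀ u, u ≠ w → ∑ r, matchingBlock c a (v, l) (u, r) * x (u, r) = 0 := by
        intro u hu
        have : s(v, u) ≠ e := fun h => hu (Sym2.congr_right.1 (h.trans hw.symm))
        simp [matchingBlock, this]
      rw [Finset.sum_eq_single w (fun u _ hu => hz u hu) (by simp),
        Finset.sum_eq_single w (fun u _ hu => by rw [hz u hu]; simp) (by simp)]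
    · push Not at h
      simp [matchingBlock, h]
  have h2 : ∀ v w, ∑ l, (∑ r, matchingBlock c a (v, l) (w, r) * x (w, r)) ^ 2 ≤
      (if s(v, w) = e then (c v * c w) ^ 2 else 0) * ∑ r, x (w, r) ^ 2 := by
    intro v w
    split_ifs with h
    · obtain ⟨σ, hσ⟩ := sum_matchingBlock_mul_fin c he a h
      simp only [hσ _ fun r => x (w, r), mul_pow (c v * c w), ← Finset.mul_sum]
      refine mul_le_mul_of_nonneg_left ?_ (sq_nonneg _)
      rw [Equiv.sum_comp σ fun r => (x (w, r) - (∑ r, x (w, r)) / k) ^ 2]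
      exact sum_sq_sub_mean_le hk _
    · simp [matchingBlock, h]
  rw [Fintype.sum_prod_type, Fintype.sum_prod_type]
  calc ∑ v, ∑ l, ((matchingBlock c a).mulVec x) (v, l) ^ 2
      = ∑ v, ∑ w, ∑ l, (∑ r, matchingBlock c a (v, l) (w, r) * x (w, r)) ^ 2 := by
        refine Finset.sum_congr rfl fun v _ => ?_
        rw [Finset.sum_comm]
        exact Finset.sum_congr rfl fun l _ => h1 v l
    _ ≤ ∑ v, ∑ w, (if s(v, w) = e then (c v * c w) ^ 2 else 0) * ∑ r, x (w, r) ^ 2 :=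
        Finset.sum_le_sum fun v _ => Finset.sum_le_sum fun w _ => h2 v w
    _ = _ := by
        rw [Finset.sum_comm]
        refine Finset.sum_congr rfl fun w _ => ?_
        rw [← Finset.sum_mul, Finset.mul_sum]

variable (G : SimpleGraph V) [DecidableRel G.Adj]

theorem sum_edgeSet_ite {β : Type*} [AddCommMonoid β] (v w : V) (f : G.edgeSet → β) :
    ∑ e : G.edgeSet, (if s(v, w) = (e : Sym2 V) then f e else 0) =
      if h : G.Adj v w then f ⟨s(v, w), G.mem_edgeSet.2 h⟩ else 0 := by
  split_ifs with h
  · rw [Finset.sum_eq_single ⟨s(v, w), G.mem_edgeSet.2 h⟩]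
    · simp
    · intro e _ he
      rw [if_neg]
      intro h'
      exact he (Subtype.ext h'.symm)
    · simp
  · refine Finset.sum_eq_zero fun e _ => if_neg fun h' => h ?_
    exact G.mem_edgeSet.1 (h' ▸ e.2)

theorem sum_matchingBlock (c : V → ℝ) (M : (e : G.edgeSet) → EdgeMatching k (e : Sym2 V)) :
    scaledAdj (fun x => c x.1) (kLift G k M) =
      ∑ e, matchingBlock c (M e) + copyMatrix V k * avgMatrix c G k := by
  classical
  ext x y
  have h1 : (copyMatrix V k * avgMatrix c G k) x y = scaledAdj c G x.1 y.1 / k := by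
    simp [Matrix.mul_apply, copyMatrix, avgMatrix]
  rw [Matrix.add_apply, h1, Matrix.sum_apply]
  simp only [matchingBlock]
  rw [sum_edgeSet_ite G x.1 y.1 fun e =>
    c x.1 * c y.1 * ((if s(x, y) ∈ (M e).pairs then 1 else 0) - 1 / (k : ℝ))]
  simp only [scaledAdj, SimpleGraph.adjMatrix_apply, kLift_adj_iff]
  by_cases h : G.Adj x.1 y.1
  · simp only [h, exists_true_left, dif_pos, if_true]
    ring
  · simp [h]

theorem avgMatrix_mul_copyMatrix (hk : 1 ≤ k) (c : V → ℝ) :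
    avgMatrix c G k * copyMatrix V k = scaledAdj c G := by
  have hk' : (k : ℝ) ≠ 0 := by positivity
  ext v w
  simp only [Matrix.mul_apply, copyMatrix, avgMatrix, Fintype.sum_prod_type]
  simp
  field_simp

theorem sum_matchingBlock_mul_copyMatrix (hk : 1 ≤ k) (c : V → ℝ)
    (M : (e : G.edgeSet) → EdgeMatching k (e : Sym2 V)) :
    (∑ e, matchingBlock c (M e)) * copyMatrix V k = 0 := by
  rw [Matrix.sum_mul]
  exact Finset.sum_eq_zero fun e _ =>
    matchingBlock_mul_copyMatrix hk c (G.not_isDiag_of_mem_edgeSet e.2) _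

-- Consequently the Laplacian scaling of the lift is pulled back from G and is not random, so the
-- blocks stay independent.
omit [DecidableEq V] in
theorem degree_kLift (M : (e : G.edgeSet) → EdgeMatching k (e : Sym2 V)) (x : V × Fin k) :
    (kLift G k M).degree x = G.degree x.1 := by
  rw [← SimpleGraph.card_neighborFinset_eq_degree, ← SimpleGraph.card_neighborFinset_eq_degree]
  refine Finset.card_bij (fun y _ => y.1) ?_ ?_ ?_
  · intro y hy
    rw [SimpleGraph.mem_neighborFinset, kLift_adj_iff] at hy
    rw [SimpleGraph.mem_neighborFinset]
    exact hy.1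
  · rintro ⟨w, r⟩ hy ⟨w', r'⟩ hy' (rfl : w = w')
    rw [SimpleGraph.mem_neighborFinset, kLift_adj_iff] at hy hy'
    obtain ⟨h, hm⟩ := hy
    obtain ⟨h', hm'⟩ := hy'
    obtain ⟨σ, hσ⟩ := (M ⟨s(x.1, w), G.mem_edgeSet.2 h⟩).exists_perm rfl h.ne
    rw [← (hσ x.2 r).1 hm, ← (hσ x.2 r').1 hm']
  · intro w hw
    rw [SimpleGraph.mem_neighborFinset] at hw
    obtain ⟨σ, hσ⟩ := (M ⟨s(x.1, w), G.mem_edgeSet.2 hw⟩).exists_perm rfl hw.ne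
    refine ⟨(w, σ x.2), ?_, rfl⟩
    rw [SimpleGraph.mem_neighborFinset, kLift_adj_iff]
    exact ⟨hw, (hσ x.2 _).2 rfl⟩

/-- The inverse square root of the degree, or `0` at isolated vertices. -/
noncomputable def invSqrtDeg {W : Type*} [Fintype W] (H : SimpleGraph W) [DecidableRel H.Adj] (v : W) : ℝ :=
  if H.degree v = 0 then 0 else (√(H.degree v : ℝ))⁻¹

theorem normLaplacian_eq {W : Type*} [Fintype W] [DecidableEq W] (H : SimpleGraph W)
    [DecidableRel H.Adj] : normLaplacian H = 1 - scaledAdj (invSqrtDeg H) H := by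
  rw [normLaplacian, invSqrtDegMatrix]
  congr 1
  ext x y
  rw [Matrix.mul_diagonal, Matrix.diagonal_mul, scaledAdj]
  simp only [invSqrtDeg]
  ring

theorem adjSpec_eq {W : Type*} [Fintype W] [DecidableEq W] (H : SimpleGraph W)
    [DecidableRel H.Adj] : adjSpec H = (scaledAdj (fun _ => 1) H).charpoly.roots := by
  have : scaledAdj (fun _ => 1) H = H.adjMatrix ℝ := by
    ext x y
    simp [scaledAdj]
  rw [this, (isHermitian_adjMatrix H).roots_charpoly_eq_eigenvalues]
  rfl

theorem lapSpec_eq {W : Type*} [Fintype W] [DecidableEq W] (H : SimpleGraph W)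
    [DecidableRel H.Adj] : lapSpec H = (1 - scaledAdj (invSqrtDeg H) H).charpoly.roots := by
  rw [← normLaplacian_eq, (isHermitian_normLaplacian H).roots_charpoly_eq_eigenvalues]
  rfl

theorem mem_roots_of_mem_newAdj (hk : 1 ≤ k) (M : (e : G.edgeSet) → EdgeMatching k (e : Sym2 V))
    {η : ℝ} (h : η ∈ newAdj G k M) :
    η ∈ (∑ e, matchingBlock (fun _ => 1) (M e)).charpoly.roots := by
  rw [newAdj, adjSpec_eq, adjSpec_eq, sum_matchingBlock G (fun _ => 1) M,
    ← avgMatrix_mul_copyMatrix G hk] at h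
  refine Multiset.mem_of_le (roots_sub_le_of_mul_eq (charpoly_add_mul_mul_X_pow
    (sum_matchingBlock_mul_copyMatrix G hk _ M)) ?_) h
  exact ((Polynomial.monic_X_pow _).mul (Matrix.charpoly_monic _)).ne_zero

theorem mem_roots_of_mem_newLap (hk : 1 ≤ k) (M : (e : G.edgeSet) → EdgeMatching k (e : Sym2 V))
    {β : ℝ} (h : β ∈ newLap G k M) :
    1 - β ∈ (∑ e, matchingBlock (invSqrtDeg G) (M e)).charpoly.roots := by
  have hc : invSqrtDeg (kLift G k M) = fun x => invSqrtDeg G x.1 := by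
    funext x
    rw [invSqrtDeg, degree_kLift, invSqrtDeg]
  rw [newLap, lapSpec_eq, lapSpec_eq, hc, sum_matchingBlock G (invSqrtDeg G) M,
    ← avgMatrix_mul_copyMatrix G hk] at h
  refine one_sub_mem_roots_charpoly (Multiset.mem_of_le (roots_sub_le_of_mul_eq
    (charpoly_one_sub_add_mul (sum_matchingBlock_mul_copyMatrix G hk _ M)) ?_) h)
  exact (((Polynomial.monic_X_sub_C _).pow _).mul (Matrix.charpoly_monic _)).ne_zero

theorem sum_edgeSet_sum_scale (c : V → ℝ) (w : V) :
    ∑ e : G.edgeSet, ∑ v, (if s(v, w) = (e : Sym2 V) then (c v * c w) ^ 2 else 0) =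
      ∑ v ∈ G.neighborFinset w, (c v * c w) ^ 2 := by
  rw [Finset.sum_comm]
  simp only [sum_edgeSet_ite G _ w fun _ => _]
  rw [G.neighborFinset_eq_filter, Finset.sum_filter]
  refine Finset.sum_congr rfl fun v _ => ?_
  simp [G.adj_comm v w]

omit [DecidableEq V] in
theorem sum_one_scale_le (w : V) :
    ∑ _v ∈ G.neighborFinset w, ((1 : ℝ) * 1) ^ 2 ≤ (G.maxDegree : ℝ) := by
  simpa using G.degree_le_maxDegree w

-- There are deg w terms, each at most 1/(d · deg w), with d the minimum degree.
omit [DecidableEq V] in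
theorem sum_invSqrtDeg_scale_le (hd : 0 < G.minDegree) (w : V) :
    ∑ v ∈ G.neighborFinset w, (invSqrtDeg G v * invSqrtDeg G w) ^ 2 ≤ 1 / (G.minDegree : ℝ) := by
  have hpos : ∀ v, 0 < G.degree v := fun v => hd.trans_le (G.minDegree_le_degree v)
  have hsq : ∀ v, invSqrtDeg G v ^ 2 = 1 / (G.degree v : ℝ) := by
    intro v
    rw [invSqrtDeg, if_neg (hpos v).ne', inv_pow, Real.sq_sqrt (Nat.cast_nonneg _), one_div]
  have hd' : (0 : ℝ) < G.minDegree := by exact_mod_cast hd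
  have hw : (0 : ℝ) < G.degree w := by exact_mod_cast hpos w
  calc ∑ v ∈ G.neighborFinset w, (invSqrtDeg G v * invSqrtDeg G w) ^ 2
      ≤ ∑ v ∈ G.neighborFinset w, 1 / (G.minDegree : ℝ) * (1 / G.degree w) := by
        refine Finset.sum_le_sum fun v _ => ?_
        rw [mul_pow, hsq, hsq]
        refine mul_le_mul_of_nonneg_right (one_div_le_one_div_of_le hd' ?_) (by positivity)
        exact_mod_cast G.minDegree_le_degree v
    _ = 1 / (G.minDegree : ℝ) := by
        rw [Finset.sum_const, G.card_neighborFinset_eq_degree, nsmul_eq_mul]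
        field_simp

end Lift


/-! ### From the probability space to finite weights -/

section Transfer

variable {Ω : Type*} [MeasurableSpace Ω] {μ : Measure Ω}

theorem ProbabilityTheory.iIndepFun.measureReal_mem_finset [IsProbabilityMeasure μ]
    {ι : Type*} [Fintype ι] {A : ι → Type*}
    [∀ i, MeasurableSpace (A i)] [∀ i, MeasurableSingletonClass (A i)] {M : (i : ι) → Ω → A i}
    (hindep : iIndepFun M μ) (hmeas : ∀ i, Measurable (M i)) (s : Finset (∀ i, A i)) :
    μ.real {ω | (fun i => M i ω) ∈ s} = ∑ m ∈ s, ∏ i, μ.real (M i ⁻¹' {m i}) := by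
  have hpre : ∀ m : ∀ i, A i, (fun ω i => M i ω) ⁻¹' {m} = ⋂ i, M i ⁻¹' {m i} := by
    intro m
    ext ω
    simp [funext_iff]
  have h := sum_measureReal_preimage_singleton (μ := μ) s (f := fun ω i => M i ω) fun m _ => by
    rw [hpre]
    exact MeasurableSet.iInter fun i => hmeas i (measurableSet_singleton _)
  have h' : {ω | (fun i => M i ω) ∈ s} = (fun ω i => M i ω) ⁻¹' (s : Set (∀ i, A i)) := rfl
  rw [h', ← h]
  refine Finset.sum_congr rfl fun m _ => ?_
  rw [hpre, measureReal_def, hindep.meas_iInter fun i => ⟨_, measurableSet_singleton (m i), rfl⟩,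
    ENNReal.toReal_prod]
  rfl

theorem sum_measureReal_preimage [IsProbabilityMeasure μ] {B : Type*} [Fintype B]
    [MeasurableSpace B] [DiscreteMeasurableSpace B] {f : Ω → B} (hf : Measurable f) (s : Finset B) :
    ∑ b ∈ s, μ.real (f ⁻¹' {b}) = μ.real (f ⁻¹' s) :=
  sum_measureReal_preimage_singleton s fun _ _ => hf (measurableSet_singleton _)

instance {V : Type*} (k : ℕ) (e : Sym2 V) : DiscreteMeasurableSpace (EdgeMatching k e) :=
  ⟨fun _ => trivial⟩

variable {V : Type*} [Fintype V] [DecidableEq V] {k : ℕ}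

-- This is where the marginal probability 1/k enters: it centres the blocks, with no uniformity
-- needed.
omit [Fintype V] in
theorem sum_measureReal_smul_matchingBlock [IsProbabilityMeasure μ] {e : Sym2 V}
    [Fintype (EdgeMatching k e)] {f : Ω → EdgeMatching k e} (hf : Measurable f) (c : V → ℝ)
    (hprob : ∀ v w l r, s(v, w) = e → μ.real {ω | s((v, l), (w, r)) ∈ (f ω).pairs} = 1 / (k : ℝ)) :
    ∑ a, μ.real (f ⁻¹' {a}) • matchingBlock c a = 0 := by
  classical
  ext ⟨v, l⟩ ⟨w, r⟩
  rw [Matrix.sum_apply, Matrix.zero_apply]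
  simp only [Matrix.smul_apply, matchingBlock, smul_eq_mul]
  by_cases h : s(v, w) = e
  · have h1 := sum_measureReal_preimage (μ := μ) hf Finset.univ
    have h2 := sum_measureReal_preimage (μ := μ) hf
      (Finset.univ.filter fun a => s((v, l), (w, r)) ∈ a.pairs)
    have h3 : f ⁻¹' ((Finset.univ.filter fun a => s((v, l), (w, r)) ∈ a.pairs :
        Finset (EdgeMatching k e)) : Set (EdgeMatching k e)) =
        {ω | s((v, l), (w, r)) ∈ (f ω).pairs} := by
      ext ω
      simp
    rw [h3, hprob v w l r h, Finset.sum_filter] at h2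
    rw [Finset.coe_univ, Set.preimage_univ, probReal_univ] at h1
    have h4 : ∀ a : EdgeMatching k e, μ.real (f ⁻¹' {a}) * (c v * c w *
        ((if s((v, l), (w, r)) ∈ a.pairs then 1 else 0) - 1 / (k : ℝ))) =
        c v * c w * (if s((v, l), (w, r)) ∈ a.pairs then μ.real (f ⁻¹' {a}) else 0) -
        c v * c w * (1 / k) * μ.real (f ⁻¹' {a}) := by
      intro a
      split_ifs <;> ring
    simp only [h, if_true, h4]
    rw [Finset.sum_sub_distrib, ← Finset.mul_sum, ← Finset.mul_sum, h1, h2]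
    ring
  · simp [h]

/-- With high probability all eigenvalues of the scaled centred adjacency matrix of a random lift
are small. -/
theorem le_measureReal_forall_root (G : SimpleGraph V) [DecidableRel G.Adj] (hk : 1 ≤ k)
    [IsProbabilityMeasure μ] {M : (e : G.edgeSet) → Ω → EdgeMatching k (e : Sym2 V)}
    (hmeas : ∀ e, Measurable (M e)) (hindep : iIndepFun M μ)
    (hprob : ∀ (v w : V) (h : G.Adj v w) (l r : Fin k),
      μ.real {ω | s((v, l), (w, r)) ∈ (M ⟨s(v, w), G.mem_edgeSet.2 h⟩ ω).pairs} = 1 / (k : ℝ))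
    {δ : ℝ} (hδ0 : 0 < δ) (hδ1 : δ < 1) (c : V → ℝ) {v : ℝ} (hv0 : 0 < v)
    (hv : ∀ w, ∑ u ∈ G.neighborFinset w, (c u * c w) ^ 2 ≤ v) :
    1 - δ ≤ μ.real {ω | ∀ t ∈ (∑ e, matchingBlock c (M e ω)).charpoly.roots,
      |t| ≤ 16 * √(v * Real.log (2 * (Fintype.card V : ℝ) * (k : ℝ) / δ))} := by
  classical
  -- The moment argument needs a nonempty index set; an empty one gives no roots.
  rcases Nat.eq_zero_or_pos (Fintype.card (V × Fin k)) with h0 | hW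
  · have : {ω | ∀ t ∈ (∑ e, matchingBlock c (M e ω)).charpoly.roots,
        |t| ≤ 16 * √(v * Real.log (2 * (Fintype.card V : ℝ) * (k : ℝ) / δ))} = Set.univ := by
      refine Set.eq_univ_of_forall fun ω t ht => ?_
      have h1 := Polynomial.card_roots' (∑ e, matchingBlock c (M e ω)).charpoly
      rw [Matrix.charpoly_natDegree_eq_dim, h0, Nat.le_zero, Multiset.card_eq_zero] at h1
      rw [h1] at ht
      exact absurd ht (Multiset.notMem_zero t)
    rw [this, probReal_univ]
    linarith
  have : ∀ e : G.edgeSet, Fintype (EdgeMatching k (e : Sym2 V)) := fun e => Fintype.ofFinite _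
  set good : ((e : G.edgeSet) → EdgeMatching k (e : Sym2 V)) → Prop := fun m =>
    ∀ t ∈ (∑ e, matchingBlock c (m e)).charpoly.roots,
      |t| ≤ 16 * √(v * Real.log (2 * (Fintype.card V : ℝ) * (k : ℝ) / δ)) with hgood
  have hcard : (2 : ℝ) * (Fintype.card V : ℝ) * (k : ℝ) = 2 * Fintype.card (V × Fin k) := by
    rw [Fintype.card_prod, Fintype.card_fin]
    push_cast
    ring
  have hbad := sum_weight_exists_root_le
    (p := fun (e : G.edgeSet) a => μ.real (M e ⁻¹' {a}))
    (X := fun (e : G.edgeSet) a => matchingBlock c a)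
    (D := fun e j => ∑ v, if s(v, j.1) = (e : Sym2 V) then (c v * c j.1) ^ 2 else 0)
    (fun _ _ => measureReal_nonneg)
    (fun e => by
      have := sum_measureReal_preimage (μ := μ) (hmeas e) Finset.univ
      rwa [Finset.coe_univ, Set.preimage_univ, probReal_univ] at this)
    (fun _ a => isHermitian_matchingBlock c a)
    (fun e => sum_measureReal_smul_matchingBlock (hmeas e) c fun v w l r h => by
      obtain ⟨e, he⟩ := e
      change s(v, w) = e at h
      subst h
      exact hprob v w he l r)
    (fun e a x => sum_sq_matchingBlock_mulVec_le hk c (G.not_isDiag_of_mem_edgeSet e.2) a x)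
    hv0 (fun j => (sum_edgeSet_sum_scale G c j.1).trans_le (hv j.1)) hδ0 hδ1 hW
    (Finset.univ.filter fun m => ¬ good m)
    (fun m hm => by
      have := (Finset.mem_filter.1 hm).2
      simp only [hgood] at this
      push Not at this
      rwa [hcard] at this)
  rw [← hindep.measureReal_mem_finset hmeas] at hbad
  -- Subadditivity suffices, so measurability of the good event is not needed.
  have hunion := measureReal_union_le (μ := μ) {ω | good fun e => M e ω}
    {ω | (fun e => M e ω) ∈ Finset.univ.filter fun m => ¬ good m}
  have huniv : {ω | good fun e => M e ω} ∪
      {ω | (fun e => M e ω) ∈ Finset.univ.filter fun m => ¬ good m} = Set.univ := by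
    ext ω
    simp [em]
  rw [huniv, probReal_univ] at hunion
  change 1 - δ ≤ μ.real {ω | good fun e => M e ω}
  linarith

end Transfer

/-! ### The two spectral bounds -/

theorem theorem1 {V : Type*} [Fintype V] [DecidableEq V] (G : SimpleGraph V) [DecidableRel G.Adj]
    (k : ℕ) (hk : 1 ≤ k)
    {Ω : Type*} [MeasurableSpace Ω] (μ : Measure Ω) [IsProbabilityMeasure μ]
    (M : (e : G.edgeSet) → Ω → EdgeMatching k (e : Sym2 V))
    (hmeas : ∀ e, Measurable (M e))
    (hindep : iIndepFun M μ)
    (hprob : ∀ (v w : V) (h : G.Adj v w) (l r : Fin k),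
      μ.real {ω | s((v, l), (w, r)) ∈ (M ⟨s(v, w), G.mem_edgeSet.2 h⟩ ω).pairs} = 1 / (k : ℝ))
    (δ : ℝ) (hδ0 : 0 < δ) (hδ1 : δ < 1) :
    1 - δ ≤ μ.real {ω | ∀ η ∈ newAdj G k (fun e => M e ω),
        |η| ≤ 16 * √((G.maxDegree : ℝ) * Real.log (2 * (Fintype.card V : ℝ) * (k : ℝ) / δ))} ∧
    (0 < G.minDegree →
      1 - δ ≤ μ.real {ω | ∀ β ∈ newLap G k (fun e => M e ω),
        |1 - β| ≤ 16 * √(Real.log (2 * (Fintype.card V : ℝ) * (k : ℝ) / δ) / (G.minDegree : ℝ))}) := by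
  constructor
  -- The tail bound needs v > 0. If Δ = 0 there are no edges, so S = 0 and every new eigenvalue
  -- vanishes.
  · rcases Nat.eq_zero_or_pos G.maxDegree with h0 | hpos
    · have : IsEmpty G.edgeSet := by
        refine ⟨fun ⟨e, he⟩ => ?_⟩
        induction e using Sym2.ind with
        | _ v w =>
        have h1 := G.degree_le_maxDegree v
        rw [h0, Nat.le_zero, G.degree_eq_zero] at h1
        exact h1 w he
      have huniv : {ω | ∀ η ∈ newAdj G k (fun e => M e ω), |η| ≤ 16 * √((G.maxDegree : ℝ) *
          Real.log (2 * (Fintype.card V : ℝ) * (k : ℝ) / δ))} = Set.univ := by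
        refine Set.eq_univ_of_forall fun ω η hη => ?_
        have h1 := mem_roots_of_mem_newAdj G hk _ hη
        rw [Finset.univ_eq_empty, Finset.sum_empty] at h1
        have h2 := eigenvalue_pow_le_trace Matrix.isHermitian_zero h1 1
        have h3 : η = 0 := by
          simpa using h2.antisymm (by rw [mul_one]; simpa using sq_nonneg η)
        rw [h3, abs_zero]
        positivity
      rw [huniv, probReal_univ]
      linarith
    · refine (le_measureReal_forall_root G hk hmeas hindep hprob hδ0 hδ1 (fun _ => 1)
        (Nat.cast_pos.2 hpos) (sum_one_scale_le G)).trans (measureReal_mono fun ω hω η hη => ?_)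
      exact hω η (mem_roots_of_mem_newAdj G hk _ hη)
  · intro hd
    refine (le_measureReal_forall_root G hk hmeas hindep hprob hδ0 hδ1 (invSqrtDeg G)
      (one_div_pos.2 (Nat.cast_pos.2 hd)) (sum_invSqrtDeg_scale_le G hd)).trans
      (measureReal_mono fun ω hω β hβ => ?_)
    have := hω (1 - β) (mem_roots_of_mem_newLap G hk _ hβ)
    rwa [one_div_mul_eq_div] at this
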